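/- **Proposition 4.15 (Uniqueness of Divisor Theories).** Conventions. A *monoid* is a cancellative semigroup with unit $1$ satisfying the left and the right Ore condition; $\mathsf q(H)$ denotes the quotient group of a monoid $H$, and homomorphisms preserve $1$. $H$ is *normalizing* if $aH=Ha$ for all $a\in H$. For $A,B\subset\mathsf q(H)$ put $AB=\{ab \mid a\in A,\ b\in B\}$, $(A:_lB)=\{x\in\mathsf q(H) \mid xB\subset A\}$ and $(A:_rB)=\{x\in\mathsf q(H) \mid Bx\subset A\}$. A *fractional ideal* is a set $A\subset\mathsf q(H)$ with $HA=A=AH$ and $Aa\subset H$, $bA\subset H$ for some $a,b\in H$; an *ideal* is a fractional ideal contained in $H$. If $H$ is normalizing, then $(H:_lA)=(H:_rA)=:A^{-1}$ for all $A\subset\mathsf q(H)$, and we put $A_v=(A^{-1})^{-1}$. In this case $\mathcal I_v^*(H)$ denotes the set of all ideals $\mathfrak a$ of $H$ with $\mathfrak a=\mathfrak a_v$ and $(\mathfrak a\mathfrak a^{-1})_v=(\mathfrak a^{-1}\mathfrak a)_v=H$; it is a monoid with unit element $H$ under $\mathfrak a\cdot_v\mathfrak b=(\mathfrak a\mathfrak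 b)_v$, and $\partial\colon H\to\mathcal I_v^*(H)$, $\partial(a)=aH$, is a homomorphism. For a homomorphism $\varphi\colon H\to D$ into a commutative monoid $D$, the *class group* of $\varphi$ is $\mathcal C(\varphi)=\mathsf q(D)/\mathsf q(\varphi(H))$, where $\mathsf q(\varphi(H))\subset\mathsf q(D)$ is the subgroup generated by $\varphi(H)$; $[a]_\varphi$ denotes the class of $a\in\mathsf q(D)$. If $H$ is normalizing and $\mathcal I_v^*(H)$ is commutative, the *$v$-class group* of $H$ is $\mathcal C_v(H)=\mathcal C(\partial)$. A *divisor theory* of $H$ is a homomorphism $\varphi\colon H\to F$ into a free abelian monoid $F=\mathcal F(P)$ with basis $P$ such that, for all $a,b\in H$, $\varphi(b)\in\varphi(a)F$ implies $b\in aH$, and $\varphi(b)\in F\varphi(a)$ implies $b\in Ha$, and such that for every $p\in P$ there is a finite non-empty set $X\subset H$ with $p=\gcd(\varphi(X))$. Let $H$ be a monoid. 1. Let $\varphi\colon H\to F=\mathcal F(P)$ be a divisor theory. Then $H$ is normalizing, $\mathcal I_v^*(H)$ is commutative, every class in $\mathcal C(\varphi)$ is of the form $[a]_\varphi$ with $a\in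 F$, and the maps $$\varphi^*\colon F\to\mathcal I_v^*(H),\quad \varphi^*(a)=\varphi^{-1}(aF)_v,\qquad\text{and}\qquad \overline\varphi\colon\mathcal C(\varphi)\to\mathcal C_v(H),\quad \overline\varphi([a]_\varphi)=[\varphi^{-1}(aF)_v]\quad(a\in F),$$ are (well defined and) isomorphisms. 2. If $\varphi_1\colon H\to F_1$ and $\varphi_2\colon H\to F_2$ are divisor theories, then there is a unique isomorphism $\Phi\colon F_1\to F_2$ with $\Phi\circ\varphi_1=\varphi_2$. It induces an isomorphism $\overline\Phi\colon\mathcal C(\varphi_1)\to\mathcal C(\varphi_2)$, given by $\overline\Phi([a]_{\varphi_1})=[\Phi(a)]_{\varphi_2}$ for all $a\in F_1$. -/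

import Mathlib

open scoped Pointwise

universe u v w

namespace DivTheory

/-! ### Monoids and their quotient groups -/

/-- The left and right Ore conditions. A *monoid* in the sense of the theory is a cancellative
semigroup with unit (`CancelMonoid`) satisfying both of them. -/
class IsOre (H : Type u) [CancelMonoid H] : Prop where
  right_ore : ∀ a b : H, ∃ x y : H, a * x = b * y
  left_ore : ∀ a b : H, ∃ x y : H, x * a = y * b

section Fractions

variable (H : Type u) [CancelMonoid H] [IsOre H]

/-- The Ore data needed by Mathlib's Ore localization of `H` at all of its elements. -/
@[reducible] noncomputable def oreSetTop : OreLocalization.OreSet (⊤ : Submonoid H) where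
  ore_right_cancel := fun _ _ _ h => ⟨1, by rw [mul_right_cancel h]⟩
  oreNum := fun r s => (IsOre.left_ore r (s : H)).choose_spec.choose
  oreDenom := fun r s => ⟨(IsOre.left_ore r (s : H)).choose, Submonoid.mem_top _⟩
  ore_eq := fun r s => (IsOre.left_ore r (s : H)).choose_spec.choose_spec

/-- The quotient group `q(H)` (the group of fractions `a⁻¹ b` with `a, b ∈ H`). -/
def FracGroup : Type u := @OreLocalization H _ ⊤ (oreSetTop H) H _

/-- `q(H)` as a monoid. -/
@[reducible] noncomputable def fracMonoid : Monoid (FracGroup H) :=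
  letI := oreSetTop H
  inferInstanceAs (Monoid (OreLocalization (⊤ : Submonoid H) H))

theorem frac_isUnit (x : FracGroup H) : @IsUnit _ (fracMonoid H) x := by
  let := oreSetTop H
  change IsUnit (M := OreLocalization (⊤ : Submonoid H) H) x
  induction x using OreLocalization.ind with
  | _ r s =>
    refine ⟨⟨OreLocalization.oreDiv r s, OreLocalization.oreDiv (s : H) ⟨r, Submonoid.mem_top _⟩,
      ?_, ?_⟩, rfl⟩
    · exact OreLocalization.mul_inv ⟨r, Submonoid.mem_top _⟩ s
    · exact OreLocalization.mul_inv s ⟨r, Submonoid.mem_top _⟩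

noncomputable instance : Group (FracGroup H) :=
  letI := fracMonoid H
  groupOfIsUnit (frac_isUnit H)

variable {H}

/-- The embedding `H ↪ q(H)`. -/
noncomputable def emb : H →* FracGroup H :=
  letI := oreSetTop H
  (OreLocalization.numeratorHom : H →* OreLocalization (⊤ : Submonoid H) H)

theorem emb_injective : Function.Injective (emb : H → FracGroup H) := by
  let := oreSetTop H
  intro a b h
  have h' : OreLocalization.oreDiv a (1 : (⊤ : Submonoid H))
      = OreLocalization.oreDiv b (1 : (⊤ : Submonoid H)) := h
  rw [OreLocalization.oreDiv_eq_iff] at h'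
  obtain ⟨x, y, h1, h2⟩ := h'
  have hxy : (x : H) = y := by simpa using h2
  rw [Submonoid.smul_def, smul_eq_mul, smul_eq_mul, hxy] at h1
  exact (mul_left_cancel h1).symm

/-- Every element of `q(H)` is a left fraction `a⁻¹ b`. -/
theorem exists_left_fraction (q : FracGroup H) : ∃ a b : H, q = (emb a)⁻¹ * emb b := by
  let := oreSetTop H
  induction q using OreLocalization.ind with
  | _ r s =>
    refine ⟨s, r, ?_⟩
    refine eq_inv_mul_of_mul_eq ?_
    change OreLocalization.oreDiv (s : H) (1 : (⊤ : Submonoid H)) * OreLocalization.oreDiv r s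
      = OreLocalization.oreDiv r 1
    exact OreLocalization.mul_cancel

/-- Every element of `q(H)` is a right fraction `b a⁻¹`. -/
theorem exists_right_fraction (q : FracGroup H) : ∃ a b : H, q = emb b * (emb a)⁻¹ := by
  obtain ⟨a, b, rfl⟩ := exists_left_fraction q
  obtain ⟨x, y, h⟩ := IsOre.right_ore a b
  refine ⟨y, x, ?_⟩
  rw [inv_mul_eq_iff_eq_mul, ← mul_assoc, eq_mul_inv_iff_mul_eq, ← map_mul, ← map_mul, h]

end Fractions

/-! ### Divisorial ideals -/

section Ideals

variable (H : Type u) [CancelMonoid H] [IsOre H]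

/-- `H` as a subset of `q(H)`. -/
def base : Set (FracGroup H) := Set.range (emb : H → FracGroup H)

variable {H}

/-- The left quotient `(A :_l B) = {x ∈ q(H) | x B ⊆ A}`. -/
def leftQuot (A B : Set (FracGroup H)) : Set (FracGroup H) := {x | ∀ b ∈ B, x * b ∈ A}

/-- The right quotient `(A :_r B) = {x ∈ q(H) | B x ⊆ A}`. -/
def rightQuot (A B : Set (FracGroup H)) : Set (FracGroup H) := {x | ∀ b ∈ B, b * x ∈ A}

/-- `A` is a fractional left ideal: `H A = A` and `A a ⊆ H` for some `a ∈ H`. -/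
def IsFracLeftIdeal (A : Set (FracGroup H)) : Prop :=
  base H * A = A ∧ ∃ a : H, ∀ x ∈ A, x * emb a ∈ base H

/-- `A` is a fractional right ideal: `A H = A` and `a A ⊆ H` for some `a ∈ H`. -/
def IsFracRightIdeal (A : Set (FracGroup H)) : Prop :=
  A * base H = A ∧ ∃ a : H, ∀ x ∈ A, emb a * x ∈ base H

/-- `A` is a (two-sided) fractional ideal of `H`. -/
def IsFracIdeal (A : Set (FracGroup H)) : Prop := IsFracLeftIdeal A ∧ IsFracRightIdeal A

/-- `A` is a (two-sided, possibly empty) ideal of `H`. -/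
def IsIdeal (A : Set (FracGroup H)) : Prop := IsFracIdeal A ∧ A ⊆ base H

/-- The divisorial closure `A_v = (H :_l (H :_r A))`. The notation `A_v` is used for sets with
`(H :_l (H :_r A)) = (H :_r (H :_l A))`, and this holds for all `A ⊆ q(H)` if `H` is normalizing,
see `rightQuot_leftQuot_eq_vClosure`. -/
def vClosure (A : Set (FracGroup H)) : Set (FracGroup H) := leftQuot (base H) (rightQuot (base H) A)

/-- `A` is divisorial: `(H :_l (H :_r A)) = A = (H :_r (H :_l A))`. -/
def IsDivisorial (A : Set (FracGroup H)) : Prop :=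
  leftQuot (base H) (rightQuot (base H) A) = A ∧ rightQuot (base H) (leftQuot (base H) A) = A

/-- The `v`-product `A ·_v B = (A B)_v`. -/
def vMul (A B : Set (FracGroup H)) : Set (FracGroup H) := vClosure (A * B)

/-- `A` is `v`-invertible: `A ·_v A⁻¹ = H = A⁻¹ ·_v A`, where `A⁻¹ = (H :_l A)`. (The notion is used
for `H` such that `(H :_l A) = (H :_r A)` for all fractional ideals `A`, see
`leftQuot_eq_rightQuot`.) -/
def IsVInvertible (A : Set (FracGroup H)) : Prop :=
  vMul A (leftQuot (base H) A) = base H ∧ vMul (leftQuot (base H) A) A = base H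

variable (H)

/-- `I_v^*(H)`: the set of all `v`-invertible divisorial ideals of `H`. -/
structure VInvIdeal where
  carrier : Set (FracGroup H)
  isIdeal : IsIdeal carrier
  isDivisorial : IsDivisorial carrier
  isVInvertible : IsVInvertible carrier

variable {H}

theorem VInvIdeal.ext' {I J : VInvIdeal H} (h : I.carrier = J.carrier) : I = J := by
  cases I; cases J; cases h; rfl

/-- The principal right ideal `a H`, as a subset of `q(H)`. -/
def principal (a : H) : Set (FracGroup H) := {x | ∃ h : H, x = emb (a * h)}

theorem one_mem_base : (1 : FracGroup H) ∈ base H := ⟨1, map_one _⟩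

theorem mul_mem_base {x y : FracGroup H} (hx : x ∈ base H) (hy : y ∈ base H) : x * y ∈ base H := by
  obtain ⟨a, rfl⟩ := hx
  obtain ⟨b, rfl⟩ := hy
  exact ⟨a * b, map_mul _ _ _⟩

theorem subset_vClosure (A : Set (FracGroup H)) : A ⊆ vClosure A := fun _ hx _ hy => hy _ hx

theorem rightQuot_vClosure (A : Set (FracGroup H)) :
    rightQuot (base H) (vClosure A) = rightQuot (base H) A := by
  ext y
  exact ⟨fun h a ha => h a (subset_vClosure A ha), fun h x hx => hx y h⟩

theorem vClosure_vClosure (A : Set (FracGroup H)) : vClosure (vClosure A) = vClosure A := by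
  rw [vClosure, rightQuot_vClosure, vClosure]

theorem vClosure_mul_left (A B : Set (FracGroup H)) : vClosure (vClosure A * B) = vClosure (A * B) := by
  unfold vClosure
  congr 1
  ext y
  constructor
  · rintro h _ ⟨a, ha, b, hb, rfl⟩
    exact h _ ⟨a, subset_vClosure A ha, b, hb, rfl⟩
  · rintro h _ ⟨x, hx, b, hb, rfl⟩
    simp only [mul_assoc]
    refine hx _ fun a ha => ?_
    rw [← mul_assoc]
    exact h _ ⟨a, ha, b, hb, rfl⟩

theorem base_eq_principal : base H = principal (1 : H) := by
  ext x
  constructor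
  · rintro ⟨h, rfl⟩
    exact ⟨h, by rw [one_mul]⟩
  · rintro ⟨h, rfl⟩
    exact ⟨_, rfl⟩

theorem principal_subset (a : H) : principal a ⊆ base H := by
  rintro _ ⟨h, rfl⟩
  exact ⟨_, rfl⟩

end Ideals

/-! ### Normalizing monoids and the monoid of `v`-invertible `v`-ideals -/

/-- `H` is normalizing: `a H = H a` for all `a ∈ H`. -/
class IsNormalizing (H : Type u) [CancelMonoid H] : Prop where
  normal : ∀ a : H, Set.range (fun h : H => a * h) = Set.range (fun h : H => h * a)

section Normalizing

variable {H : Type u} [CancelMonoid H] [IsOre H] [IsNormalizing H]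

theorem conj_mem_base {q : FracGroup H} (g : FracGroup H) (hq : q ∈ base H) : g * q * g⁻¹ ∈ base H := by
  have key1 : ∀ (a : H) {q : FracGroup H}, q ∈ base H → emb a * q * (emb a)⁻¹ ∈ base H := by
    rintro a _ ⟨h, rfl⟩
    have : a * h ∈ Set.range (fun h : H => h * a) := by
      rw [← IsNormalizing.normal a]; exact ⟨h, rfl⟩
    obtain ⟨k, hk⟩ := this
    refine ⟨k, ?_⟩
    rw [eq_mul_inv_iff_mul_eq, ← map_mul, ← map_mul]
    exact congrArg emb hk
  have key2 : ∀ (a : H) {q : FracGroup H}, q ∈ base H → (emb a)⁻¹ * q * emb a ∈ base H := by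
    rintro a _ ⟨h, rfl⟩
    have : h * a ∈ Set.range (fun h : H => a * h) := by
      rw [IsNormalizing.normal a]; exact ⟨h, rfl⟩
    obtain ⟨k, hk⟩ := this
    refine ⟨k, ?_⟩
    rw [mul_assoc, eq_inv_mul_iff_mul_eq, ← map_mul, ← map_mul]
    exact congrArg emb hk
  obtain ⟨a, b, rfl⟩ := exists_left_fraction g
  have := key2 a (key1 b hq)
  simpa [mul_assoc] using this

theorem mul_comm_mem_base {x y : FracGroup H} (h : x * y ∈ base H) : y * x ∈ base H := by
  have := conj_mem_base y h
  simpa [mul_assoc] using this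

theorem leftQuot_eq_rightQuot (A : Set (FracGroup H)) :
    leftQuot (base H) A = rightQuot (base H) A := by
  ext x
  exact ⟨fun h a ha => mul_comm_mem_base (h a ha), fun h a ha => mul_comm_mem_base (h a ha)⟩

theorem rightQuot_leftQuot_eq_vClosure (A : Set (FracGroup H)) :
    rightQuot (base H) (leftQuot (base H) A) = vClosure A := by
  rw [vClosure, leftQuot_eq_rightQuot A, leftQuot_eq_rightQuot]

theorem isDivisorial_vClosure (A : Set (FracGroup H)) : IsDivisorial (vClosure A) :=
  ⟨vClosure_vClosure A, by rw [rightQuot_leftQuot_eq_vClosure, vClosure_vClosure]⟩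

theorem vClosure_mul_right (A B : Set (FracGroup H)) :
    vClosure (A * vClosure B) = vClosure (A * B) := by
  unfold vClosure
  congr 1
  ext y
  constructor
  · rintro h _ ⟨a, ha, b, hb, rfl⟩
    exact h _ ⟨a, ha, b, subset_vClosure B hb, rfl⟩
  · rintro h _ ⟨a, ha, x, hx, rfl⟩
    simp only [mul_assoc]
    apply mul_comm_mem_base
    rw [mul_assoc]
    refine hx _ fun b hb => ?_
    rw [← mul_assoc]
    apply mul_comm_mem_base
    rw [← mul_assoc]
    exact h _ ⟨a, ha, b, hb, rfl⟩

theorem isIdeal_vClosure {A : Set (FracGroup H)} (hA : A ⊆ base H) : IsIdeal (vClosure A) := by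
  have hsub : vClosure A ⊆ base H := fun x hx => by
    simpa using hx 1 fun a ha => by simpa using hA ha
  refine ⟨⟨⟨?_, 1, fun x hx => by simpa using hsub hx⟩,
    ⟨?_, 1, fun x hx => by simpa using hsub hx⟩⟩, hsub⟩
  · apply Set.Subset.antisymm
    · rintro _ ⟨h, hh, x, hx, rfl⟩ y hy
      simp only [mul_assoc]
      exact mul_mem_base hh (hx y hy)
    · exact fun x hx => ⟨1, one_mem_base, x, hx, one_mul x⟩
  · apply Set.Subset.antisymm
    · rintro _ ⟨x, hx, h, hh, rfl⟩ y hy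
      have := mul_mem_base (hx y hy) (conj_mem_base y⁻¹ hh)
      simpa [mul_assoc] using this
    · exact fun x hx => ⟨x, hx, 1, one_mem_base, mul_one x⟩

theorem vClosure_eq_base_iff {A : Set (FracGroup H)} (hA : A ⊆ base H) :
    vClosure A = base H ↔ ∀ y, (∀ a ∈ A, a * y ∈ base H) → y ∈ base H := by
  constructor
  · intro h y hy
    have h1 : (1 : FracGroup H) ∈ vClosure A := h ▸ one_mem_base
    simpa using h1 y hy
  · intro h
    exact Set.Subset.antisymm (isIdeal_vClosure hA).2
      fun x hx y hy => mul_mem_base hx (h y hy)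

theorem isVInvertible_iff (A : Set (FracGroup H)) : IsVInvertible A ↔
    (∀ y, (∀ a ∈ A, ∀ f ∈ leftQuot (base H) A, f * y * a ∈ base H) → y ∈ base H) ∧
    (∀ y, (∀ a ∈ A, ∀ f ∈ leftQuot (base H) A, a * y * f ∈ base H) → y ∈ base H) := by
  unfold IsVInvertible vMul
  rw [vClosure_eq_base_iff, vClosure_eq_base_iff]
  · refine and_congr (forall_congr' fun y => imp_congr_left ?_)
      (forall_congr' fun y => imp_congr_left ?_)
    · constructor
      · intro h a ha f hf
        apply mul_comm_mem_base
        rw [← mul_assoc]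
        exact h _ ⟨a, ha, f, hf, rfl⟩
      · rintro h _ ⟨a, ha, f, hf, rfl⟩
        simp only [mul_assoc]
        exact mul_comm_mem_base (h a ha f hf)
    · constructor
      · intro h a ha f hf
        apply mul_comm_mem_base
        rw [← mul_assoc]
        exact h _ ⟨f, hf, a, ha, rfl⟩
      · rintro h _ ⟨f, hf, a, ha, rfl⟩
        simp only [mul_assoc]
        exact mul_comm_mem_base (h a ha f hf)
  · rintro _ ⟨f, hf, a, ha, rfl⟩
    exact hf a ha
  · rintro _ ⟨a, ha, f, hf, rfl⟩
    exact mul_comm_mem_base (hf a ha)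

theorem leftQuot_vClosure (A : Set (FracGroup H)) :
    leftQuot (base H) (vClosure A) = leftQuot (base H) A := by
  rw [leftQuot_eq_rightQuot, rightQuot_vClosure, leftQuot_eq_rightQuot]

theorem isVInvertible_vMul {A B : Set (FracGroup H)} (hA : IsVInvertible A) (hB : IsVInvertible B) :
    IsVInvertible (vMul A B) := by
  rw [isVInvertible_iff] at hA hB ⊢
  unfold vMul
  rw [leftQuot_vClosure]
  have hquot : ∀ f ∈ leftQuot (base H) A, ∀ e ∈ leftQuot (base H) B,
      e * f ∈ leftQuot (base H) (A * B) := by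
    rintro f hf e he _ ⟨a, ha, b, hb, rfl⟩
    have := mul_mem_base (he b hb) (conj_mem_base b⁻¹ (hf a ha))
    simpa [mul_assoc] using this
  constructor
  · intro y hy
    refine hA.1 y fun a ha f hf => hB.1 _ fun b hb e he => ?_
    have := hy (a * b) (subset_vClosure _ ⟨a, ha, b, hb, rfl⟩) _ (hquot f hf e he)
    simpa only [mul_assoc] using this
  · intro y hy
    refine hB.2 y fun b hb e he => hA.2 _ fun a ha f hf => ?_
    have := hy (a * b) (subset_vClosure _ ⟨a, ha, b, hb, rfl⟩) _ (hquot f hf e he)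
    simpa only [mul_assoc] using this

theorem vClosure_principal (a : H) : vClosure (principal a) = principal a := by
  refine Set.Subset.antisymm (fun x hx => ?_) (subset_vClosure _)
  have h1 : x * (emb a)⁻¹ ∈ base H := by
    refine hx _ ?_
    rintro _ ⟨h, rfl⟩
    rw [map_mul]
    exact conj_mem_base _ ⟨h, rfl⟩
  obtain ⟨h, hh⟩ := mul_comm_mem_base h1
  exact ⟨h, by rw [map_mul, hh, mul_inv_cancel_left]⟩

theorem isVInvertible_principal (a : H) : IsVInvertible (principal a) := by
  have ha : emb a ∈ principal a := ⟨1, by rw [mul_one]⟩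
  have hf : (emb a)⁻¹ ∈ leftQuot (base H) (principal a) := by
    rintro _ ⟨h, rfl⟩
    exact ⟨h, by rw [map_mul, inv_mul_cancel_left]⟩
  rw [isVInvertible_iff]
  constructor
  · intro y hy
    have := conj_mem_base (emb a) (hy _ ha _ hf)
    simpa [mul_assoc] using this
  · intro y hy
    have := conj_mem_base (emb a)⁻¹ (hy _ ha _ hf)
    simpa [mul_assoc] using this

theorem principal_mul_principal (a b : H) : principal a * principal b = principal (a * b) := by
  ext x
  constructor
  · rintro ⟨_, ⟨h, rfl⟩, _, ⟨k, rfl⟩, rfl⟩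
    have : h * b ∈ Set.range (fun h : H => b * h) := by
      rw [IsNormalizing.normal b]; exact ⟨h, rfl⟩
    obtain ⟨l, hl⟩ := this
    refine ⟨l * k, ?_⟩
    have hl' : b * l = h * b := hl
    refine (map_mul emb _ _).symm.trans (congrArg emb ?_)
    rw [mul_assoc, ← mul_assoc h, ← hl']
    simp only [mul_assoc]
  · rintro ⟨h, rfl⟩
    refine ⟨emb a, ⟨1, by rw [mul_one]⟩, emb (b * h), ⟨h, rfl⟩, ?_⟩
    exact (map_mul emb _ _).symm.trans (congrArg emb (mul_assoc _ _ _).symm)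

/-- The principal ideal `a H` as an element of `I_v^*(H)`. -/
def principalIdeal (a : H) : VInvIdeal H where
  carrier := principal a
  isIdeal := vClosure_principal a ▸ isIdeal_vClosure (principal_subset a)
  isDivisorial := vClosure_principal a ▸ isDivisorial_vClosure (principal a)
  isVInvertible := isVInvertible_principal a

/-- `I_v^*(H)` is a monoid under `v`-multiplication, with unit element `H`. -/
instance : Monoid (VInvIdeal H) where
  mul I J :=
    { carrier := vMul I.carrier J.carrier
      isIdeal := isIdeal_vClosure <| by
        rintro _ ⟨a, ha, b, hb, rfl⟩
        exact mul_mem_base (I.isIdeal.2 ha) (J.isIdeal.2 hb)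
      isDivisorial := isDivisorial_vClosure _
      isVInvertible := isVInvertible_vMul I.isVInvertible J.isVInvertible }
  mul_assoc I J K := VInvIdeal.ext' <| by
    change vClosure (vClosure (I.carrier * J.carrier) * K.carrier)
      = vClosure (I.carrier * vClosure (J.carrier * K.carrier))
    rw [vClosure_mul_left, vClosure_mul_right, mul_assoc]
  one :=
    { carrier := base H
      isIdeal := base_eq_principal (H := H) ▸ (principalIdeal (1 : H)).isIdeal
      isDivisorial := base_eq_principal (H := H) ▸ (principalIdeal (1 : H)).isDivisorial
      isVInvertible := base_eq_principal (H := H) ▸ (principalIdeal (1 : H)).isVInvertible }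
  one_mul I := VInvIdeal.ext' <| by
    change vClosure (base H * I.carrier) = I.carrier
    rw [I.isIdeal.1.1.1]
    exact I.isDivisorial.1
  mul_one I := VInvIdeal.ext' <| by
    change vClosure (I.carrier * base H) = I.carrier
    rw [I.isIdeal.1.2.1]
    exact I.isDivisorial.1

variable (H)

/-- The homomorphism `∂ : H → I_v^*(H)`, `a ↦ a H`. -/
def principalHom : H →* VInvIdeal H where
  toFun := principalIdeal
  map_one' := VInvIdeal.ext' base_eq_principal.symm
  map_mul' a b := VInvIdeal.ext' <| by
    change principal (a * b) = vClosure (principal a * principal b)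
    rw [principal_mul_principal, vClosure_principal]

/-- `v`-multiplication of `v`-invertible `v`-ideals is commutative. -/
class IsVCommutative : Prop where
  mul_comm : ∀ I J : VInvIdeal H, I * J = J * I

variable {H}

instance [IsVCommutative H] : CommMonoid (VInvIdeal H) :=
  { (inferInstance : Monoid (VInvIdeal H)) with mul_comm := IsVCommutative.mul_comm }

end Normalizing

/-! ### Class groups -/

section ClassGroup

variable {H : Type u} [CancelMonoid H] {D : Type v} [CommMonoid D]

/-- `q(φ(H))`, as the subgroup of `q(D)` generated by `φ(H)`. -/
def imageSubgroup (φ : H →* D) : Subgroup (Algebra.GrothendieckGroup D) :=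
  Subgroup.closure (Set.range fun h : H => Algebra.GrothendieckGroup.of (φ h))

/-- The class group `C(φ) = q(D) / q(φ(H))` of a homomorphism `φ : H → D` into a commutative
monoid (written multiplicatively). -/
abbrev DivClassGroup (φ : H →* D) : Type v := Algebra.GrothendieckGroup D ⧸ imageSubgroup φ

/-- The class `[a]_φ` of an element `a ∈ D`. -/
def cls (φ : H →* D) (a : D) : DivClassGroup φ :=
  QuotientGroup.mk (Algebra.GrothendieckGroup.of a)

end ClassGroup

/-- The `v`-class group `C_v(H) = C(∂)`, where `∂ : H → I_v^*(H)`, `a ↦ a H`. -/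
abbrev VClassGroup (H : Type u) [CancelMonoid H] [IsOre H] [IsNormalizing H] [IsVCommutative H] :
    Type u := DivClassGroup (principalHom H)

/-! ### Divisor theories -/

section DivisorTheories

variable {F : Type v} [CommMonoid F]

/-- `F` is the free abelian monoid with basis `P ⊆ F`: every `a ∈ F` has a unique representation
`a = ∏ p ^ v_p(a)` with exponents in `ℕ`, almost all of them zero. -/
def IsFreeBasis (P : Set F) : Prop :=
  Function.Bijective fun e : P →₀ ℕ => e.prod fun p n => (p : F) ^ n

/-- `d` is a greatest common divisor of the elements of `S`. -/
def IsGCDOf (S : Set F) (d : F) : Prop :=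
  (∀ s ∈ S, d ∣ s) ∧ ∀ e : F, (∀ s ∈ S, e ∣ s) → e ∣ d

variable {H : Type u} [CancelMonoid H]

/-- `φ` is a (left and right) divisor homomorphism. Note that `∣` is left divisibility. -/
def IsDivisorHom (φ : H →* F) : Prop :=
  (∀ a b : H, φ a ∣ φ b → a ∣ b) ∧
  (∀ a b : H, (∃ c : F, φ b = c * φ a) → ∃ c : H, b = c * a)

/-- `φ : H → F` is a divisor theory: a divisor homomorphism into a free abelian monoid `F = F(P)`
such that every `p ∈ P` is the greatest common divisor of `φ(X)` for a finite non-empty `X ⊆ H`. -/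
def IsDivisorTheory (φ : H →* F) : Prop :=
  IsDivisorHom φ ∧ ∃ P : Set F, IsFreeBasis P ∧
    ∀ p ∈ P, ∃ X : Finset H, X.Nonempty ∧ IsGCDOf (φ '' (X : Set H)) p

variable [IsOre H]

/-- The set `φ⁻¹(a F)`, as a subset of `q(H)`. -/
def preimageIdeal (φ : H →* F) (a : F) : Set (FracGroup H) :=
  emb '' {h : H | φ h ∈ Set.range fun x : F => a * x}

end DivisorTheories

end DivTheory

namespace DivTheory

/-! ### Greatest common divisors -/

section GCD

variable {F : Type v} [CommMonoid F]

/-! A free abelian monoid is cancellative and reduced, and every non-empty subset has a gcd; gcds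
are compatible with products (`IsGCDOf.mul`). In a divisor theory every `a ∈ F` is the gcd of `φ(X)`
for some `X ⊆ H` (`IsDivisorTheory.exists_isGCDOf`), so elements of `F` are determined by sets of
elements of `H`.

The central fact is `IsDivisorTheory.vClosure_image`: if `d = gcd φ(A)` with `A ⊆ H` non-empty, then
`A_v = φ⁻¹(dF)`. Indeed `z x⁻¹` lies in `A⁻¹` iff `φ(x)` divides every `φ(a) φ(z)`, that is, iff
`φ(x) ∣ d φ(z)`. Hence `a ↦ φ⁻¹(aF)` is multiplicative, its values are divisorial and
`v`-invertible, it is injective because `a` is the gcd of `φ(φ⁻¹(aF))`, and it is onto because gcds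
exist.

This isomorphism sends `φ(h)` to `hH`, so it descends to class groups. Two divisor theories are
compared through `I_v^*(H)`; uniqueness holds because isomorphisms preserve gcds. -/

/-- `F` is a cancellative reduced monoid in which all non-empty sets have greatest common
divisors. -/
structure IsCompleteGCD (F : Type v) [CommMonoid F] : Prop where
  isCancelMul : IsCancelMul F
  dvd_antisymm : ∀ a b : F, a ∣ b → b ∣ a → a = b
  exists_gcd : ∀ S : Set F, S.Nonempty → ∃ d, IsGCDOf S d

/-- Divisibility is the pointwise order on exponents, and gcds are pointwise minima. -/
theorem isCompleteGCD_finsupp (P : Type v) : IsCompleteGCD (Multiplicative (P →₀ ℕ)) where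
  isCancelMul := inferInstance
  dvd_antisymm := by
    rintro a b ⟨x, rfl⟩ ⟨y, hy⟩
    have h : Multiplicative.toAdd a + Multiplicative.toAdd x ≤ Multiplicative.toAdd a :=
      le_iff_exists_add.2 ⟨Multiplicative.toAdd y, hy⟩
    exact le_antisymm (α := P →₀ ℕ) (le_iff_exists_add.2 ⟨Multiplicative.toAdd x, rfl⟩) h
  exists_gcd := by
    rintro S ⟨s₀, hs₀⟩
    have hdvd : ∀ a b : Multiplicative (P →₀ ℕ),
        a ∣ b ↔ ∀ p, Multiplicative.toAdd a p ≤ Multiplicative.toAdd b p :=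
      fun a b => (le_iff_exists_add (a := Multiplicative.toAdd a)
        (b := Multiplicative.toAdd b)).symm.trans Finsupp.le_def
    let m : P → ℕ := fun p => sInf ((fun s : Multiplicative (P →₀ ℕ) => Multiplicative.toAdd s p) '' S)
    have hm : ∀ s ∈ S, ∀ p, m p ≤ Multiplicative.toAdd s p :=
      fun s hs p => Nat.sInf_le ⟨s, hs, rfl⟩
    -- The minimum is bounded by the exponents of `s₀`, so its support is finite.
    let d : P →₀ ℕ := Finsupp.onFinset (Multiplicative.toAdd s₀).support m fun p hp =>
      Finsupp.mem_support_iff.2 fun h => hp (Nat.le_zero.1 (h ▸ hm s₀ hs₀ p))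
    refine ⟨Multiplicative.ofAdd d, fun s hs => (hdvd _ _).2 (hm s hs), fun e he =>
      (hdvd _ _).2 fun p => ?_⟩
    refine le_csInf ⟨_, s₀, hs₀, rfl⟩ ?_
    rintro _ ⟨s, hs, rfl⟩
    exact (hdvd _ _).1 (he s hs) p

theorem IsCompleteGCD.of_mulEquiv {E : Type w} [CommMonoid E] (hE : IsCompleteGCD E)
    (e : E ≃* F) : IsCompleteGCD F where
  isCancelMul :=
    have := hE.isCancelMul
    e.symm.injective.isCancelMul e.symm (map_mul e.symm)
  dvd_antisymm a b hab hba :=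
    e.symm.injective (hE.dvd_antisymm _ _ (map_dvd e.symm hab) (map_dvd e.symm hba))
  exists_gcd S hS := by
    obtain ⟨d, hd, hd'⟩ := hE.exists_gcd (e.symm '' S) (hS.image _)
    have key : ∀ (x : E) (y : F), x ∣ e.symm y ↔ e x ∣ y := fun x y => by
      rw [← map_dvd_iff e, MulEquiv.apply_symm_apply]
    refine ⟨e d, fun s hs => (key _ _).1 (hd _ ⟨s, hs, rfl⟩), fun f hf => ?_⟩
    rw [← map_dvd_iff e.symm, MulEquiv.symm_apply_apply]
    refine hd' _ ?_
    rintro _ ⟨s, hs, rfl⟩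
    exact map_dvd e.symm (hf s hs)

/-- The isomorphism between the additive monoid of exponents and a free abelian monoid. -/
noncomputable def IsFreeBasis.mulEquiv {P : Set F} (hP : IsFreeBasis P) :
    Multiplicative (P →₀ ℕ) ≃* F :=
  MulEquiv.ofBijective
    ({ toFun := fun e => (Multiplicative.toAdd e).prod fun p n => (p : F) ^ n
       map_one' := Finsupp.prod_zero_index
       map_mul' := fun _ _ => Finsupp.prod_add_index' (fun _ => pow_zero _)
        fun _ _ _ => pow_add _ _ _ } : Multiplicative (P →₀ ℕ) →* F) hP

theorem IsFreeBasis.isCompleteGCD {P : Set F} (hP : IsFreeBasis P) : IsCompleteGCD F :=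
  (isCompleteGCD_finsupp P).of_mulEquiv hP.mulEquiv

theorem IsFreeBasis.induction {P : Set F} (hP : IsFreeBasis P) {C : F → Prop} (one : C 1)
    (mul : ∀ a b, C a → C b → C (a * b)) (basis : ∀ p ∈ P, C p) (a : F) : C a := by
  obtain ⟨e, rfl⟩ := hP.2 a
  refine Finset.prod_induction _ C mul one fun p _ => ?_
  beta_reduce
  induction e p with
  | zero => simpa using one
  | succ n ih =>
    rw [pow_succ]
    exact mul _ _ ih (basis _ p.2)

theorem IsGCDOf.unique (hF : IsCompleteGCD F) {S : Set F} {d e : F} (hd : IsGCDOf S d)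
    (he : IsGCDOf S e) : d = e :=
  hF.dvd_antisymm _ _ (he.2 _ hd.1) (hd.2 _ he.1)

/-- A gcd `g` of `S c` is divisible by `c`, say `g = c k`; cancelling `c` shows that `k` divides all
of `S`, so `k ∣ d` and `e ∣ g ∣ d c`. This lemma replaces a family of divisibilities by a single
one. -/
theorem IsGCDOf.dvd_mul (hF : IsCompleteGCD F) {S : Set F} (hS : S.Nonempty) {d : F}
    (hd : IsGCDOf S d) {c e : F} (h : ∀ s ∈ S, e ∣ s * c) : e ∣ d * c := by
  have := hF.isCancelMul
  obtain ⟨g, hg, hg'⟩ := hF.exists_gcd ((fun s => s * c) '' S) (hS.image _)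
  have hcg : c ∣ g := hg' c (by rintro _ ⟨s, -, rfl⟩; exact Dvd.intro_left _ rfl)
  obtain ⟨k, rfl⟩ := hcg
  have hk : k ∣ d := hd.2 _ fun s hs => by
    obtain ⟨t, ht⟩ := hg _ ⟨s, hs, rfl⟩
    exact ⟨t, mul_left_cancel (a := c) (by rw [← mul_assoc, ← ht, mul_comm])⟩
  refine (hg' e ?_).trans (mul_comm d c ▸ mul_dvd_mul_left c hk)
  rintro _ ⟨s, hs, rfl⟩
  exact h s hs

theorem IsGCDOf.mul (hF : IsCompleteGCD F) {S T : Set F} (hS : S.Nonempty) (hT : T.Nonempty)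
    {d e : F} (hd : IsGCDOf S d) (he : IsGCDOf T e) : IsGCDOf (S * T) (d * e) := by
  constructor
  · rintro _ ⟨s, hs, t, ht, rfl⟩
    exact mul_dvd_mul (hd.1 s hs) (he.1 t ht)
  · intro f hf
    refine hd.dvd_mul hF hS fun s hs => ?_
    rw [mul_comm]
    refine he.dvd_mul hF hT fun t ht => ?_
    rw [mul_comm]
    exact hf _ ⟨s, hs, t, ht, rfl⟩

theorem IsGCDOf.map {E : Type w} [CommMonoid E] (e : E ≃* F) {S : Set E} {d : E}
    (hd : IsGCDOf S d) : IsGCDOf (e '' S) (e d) := by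
  constructor
  · rintro _ ⟨s, hs, rfl⟩
    exact map_dvd e (hd.1 s hs)
  · intro f hf
    rw [← map_dvd_iff e.symm, MulEquiv.symm_apply_apply]
    refine hd.2 _ fun s hs => ?_
    rw [← map_dvd_iff e, MulEquiv.apply_symm_apply]
    exact hf _ ⟨s, hs, rfl⟩

end GCD

/-! ### Divisorial ideals and divisor theories -/

section Basic

variable {H : Type u} [CancelMonoid H] {F : Type v} [CommMonoid F] {φ : H →* F}

/-- As `F` is commutative, `φ a` divides `φ (a * h)` and `φ (h * a)` from both sides, and each
divisor condition lifts this to `H`. -/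
theorem IsDivisorHom.isNormalizing (hφ : IsDivisorHom φ) : IsNormalizing H where
  normal a := by
    ext x
    constructor
    · rintro ⟨h, rfl⟩
      obtain ⟨c, hc⟩ := hφ.2 a (a * h) ⟨φ h, by rw [map_mul, mul_comm]⟩
      exact ⟨c, hc.symm⟩
    · rintro ⟨h, rfl⟩
      obtain ⟨c, hc⟩ := hφ.1 a (h * a) ⟨φ h, by rw [map_mul, mul_comm]⟩
      exact ⟨c, hc.symm⟩

theorem IsDivisorTheory.isCompleteGCD (hφ : IsDivisorTheory φ) : IsCompleteGCD F := by
  obtain ⟨-, P, hP, -⟩ := hφ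
  exact hP.isCompleteGCD

/-- Every element of `F` is the greatest common divisor of the image of a non-empty set. -/
theorem IsDivisorTheory.exists_isGCDOf (hφ : IsDivisorTheory φ) (a : F) :
    ∃ X : Set H, X.Nonempty ∧ IsGCDOf (φ '' X) a := by
  have hF := hφ.isCompleteGCD
  obtain ⟨-, P, hP, hX⟩ := hφ
  refine hP.induction (C := fun a => ∃ X : Set H, X.Nonempty ∧ IsGCDOf (φ '' X) a) ?_ ?_ ?_ a
  · refine ⟨{1}, Set.singleton_nonempty _, fun s _ => one_dvd s, fun e he => ?_⟩
    exact he 1 ⟨1, rfl, map_one φ⟩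
  · rintro a b ⟨X, hX, ha⟩ ⟨Y, hY, hb⟩
    refine ⟨X * Y, hX.mul hY, ?_⟩
    rw [Set.image_mul]
    exact ha.mul hF (hX.image _) (hY.image _) hb
  · intro p hp
    obtain ⟨X, hne, hX⟩ := hX p hp
    exact ⟨X, hne, hX⟩

/-- Every element of `F` divides an element of `φ(H)`. -/
theorem IsDivisorTheory.exists_mul_eq (hφ : IsDivisorTheory φ) (a : F) :
    ∃ (e : F) (x : H), φ x = a * e := by
  obtain ⟨X, ⟨x, hx⟩, ha⟩ := hφ.exists_isGCDOf a
  obtain ⟨e, he⟩ := ha.1 _ ⟨x, hx, rfl⟩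
  exact ⟨e, x, he⟩

/-- The greatest common divisor of all elements of `φ(H)` divisible by `a` is `a`. -/
theorem IsDivisorTheory.isGCDOf_preimage (hφ : IsDivisorTheory φ) (a : F) :
    IsGCDOf (φ '' {h | a ∣ φ h}) a := by
  obtain ⟨X, -, ha⟩ := hφ.exists_isGCDOf a
  -- The set contains `X`, so its common divisors are common divisors of `φ(X)`.
  refine ⟨?_, fun e he => ha.2 e ?_⟩
  · rintro _ ⟨h, hh, rfl⟩
    exact hh
  · rintro _ ⟨h, hh, rfl⟩
    exact he _ ⟨h, ha.1 _ ⟨h, hh, rfl⟩, rfl⟩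

theorem IsDivisorTheory.preimage_nonempty (hφ : IsDivisorTheory φ) (a : F) :
    {h | a ∣ φ h}.Nonempty := by
  obtain ⟨e, x, h⟩ := hφ.exists_mul_eq a
  exact ⟨x, e, h⟩

/-- Isomorphisms under `H` out of the target of a divisor theory are unique. -/
theorem IsDivisorTheory.mulEquiv_unique (hφ : IsDivisorTheory φ) {E : Type w} [CommMonoid E]
    (hE : IsCompleteGCD E) {ψ : H →* E} {e f : F ≃* E} (he : ∀ h, e (φ h) = ψ h)
    (hf : ∀ h, f (φ h) = ψ h) : e = f := by
  ext a
  obtain ⟨X, -, ha⟩ := hφ.exists_isGCDOf a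
  have himage : e '' (φ '' X) = f '' (φ '' X) := by
    simp only [Set.image_image, he, hf]
  exact (ha.map e).unique hE (himage ▸ ha.map f)

/-! ### Divisorial closures computed by gcds -/

variable [IsOre H]

/-- The bridge between fractions and `F`: questions about `q(H)` become divisibilities in a
commutative monoid. -/
theorem IsDivisorHom.emb_mul_inv_mem_base_iff (hφ : IsDivisorHom φ) (a b : H) :
    emb b * (emb a)⁻¹ ∈ base H ↔ φ a ∣ φ b := by
  constructor
  · rintro ⟨h, hh⟩
    rw [eq_mul_inv_iff_mul_eq, ← map_mul] at hh
    rw [← emb_injective hh, map_mul]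
    exact Dvd.intro_left _ rfl
  · rintro ⟨c, hc⟩
    obtain ⟨h, rfl⟩ := hφ.2 a b ⟨c, by rw [hc, mul_comm]⟩
    exact ⟨h, by rw [map_mul, mul_inv_cancel_right]⟩

theorem preimageIdeal_eq (φ : H →* F) (a : F) : preimageIdeal φ a = emb '' {h | a ∣ φ h} := by
  unfold preimageIdeal
  congr 1
  ext h
  exact ⟨fun ⟨x, hx⟩ => ⟨x, hx.symm⟩, fun ⟨x, hx⟩ => ⟨x, hx.symm⟩⟩

theorem emb_mem_preimageIdeal {a : F} {h : H} : emb h ∈ preimageIdeal φ a ↔ a ∣ φ h := by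
  rw [preimageIdeal_eq, emb_injective.mem_set_image]
  exact Iff.rfl

theorem preimageIdeal_subset (φ : H →* F) (a : F) : preimageIdeal φ a ⊆ base H := by
  rintro _ ⟨h, -, rfl⟩
  exact ⟨h, rfl⟩

theorem IsDivisorHom.preimageIdeal_apply (hφ : IsDivisorHom φ) (h : H) :
    preimageIdeal φ (φ h) = principal h := by
  rw [preimageIdeal_eq]
  ext x
  constructor
  · rintro ⟨k, hk, rfl⟩
    obtain ⟨c, rfl⟩ := hφ.1 _ _ hk
    exact ⟨c, rfl⟩
  · rintro ⟨k, rfl⟩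
    exact ⟨h * k, ⟨φ k, map_mul _ _ _⟩, rfl⟩

theorem vClosure_subset_base {A : Set (FracGroup H)} (hA : A ⊆ base H) : vClosure A ⊆ base H :=
  fun x hx => by simpa using hx 1 fun a ha => by simpa using hA ha

/-- The divisorial closure of a non-empty set `A ⊆ H` is determined by the greatest common divisor
of `φ(A)`. -/
theorem IsDivisorTheory.vClosure_image (hφ : IsDivisorTheory φ) {A : Set H} (hA : A.Nonempty)
    {d : F} (hd : IsGCDOf (φ '' A) d) : vClosure (emb '' A) = preimageIdeal φ d := by
  have hF := hφ.isCompleteGCD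
  have := hF.isCancelMul
  have hmem : ∀ x z h : H, emb h * (emb z * (emb x)⁻¹) ∈ base H ↔ φ x ∣ φ h * φ z := by
    intro x z h
    rw [← mul_assoc, ← map_mul, hφ.1.emb_mul_inv_mem_base_iff, map_mul]
  -- The inverse of `A` depends only on `d`.
  have hquot : ∀ x z : H,
      emb z * (emb x)⁻¹ ∈ rightQuot (base H) (emb '' A) ↔ φ x ∣ d * φ z := by
    intro x z
    constructor
    · intro h
      refine hd.dvd_mul hF (hA.image _) ?_
      rintro _ ⟨a, ha, rfl⟩
      exact (hmem x z a).1 (h _ ⟨a, ha, rfl⟩)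
    · rintro h _ ⟨a, ha, rfl⟩
      exact (hmem x z a).2 (h.trans (mul_dvd_mul_right (hd.1 _ ⟨a, ha, rfl⟩) _))
  ext w
  constructor
  · intro hw
    obtain ⟨h, rfl⟩ := vClosure_subset_base (by rintro _ ⟨a, -, rfl⟩; exact ⟨a, rfl⟩) hw
    rw [emb_mem_preimageIdeal]
    obtain ⟨e, x, hx⟩ := hφ.exists_mul_eq d
    -- With `φ x = d * e`, every `z` with `e ∣ φ z` gives `z x⁻¹ ∈ A⁻¹`, so `φ x ∣ φ h * φ z`. The
    -- gcd of these `φ z` is `e`; cancelling `e` afterwards leaves `d ∣ φ h`.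
    have : d * e ∣ e * φ h := by
      refine (hφ.isGCDOf_preimage e).dvd_mul hF ((hφ.preimage_nonempty e).image _) ?_
      rintro _ ⟨z, hz, rfl⟩
      rw [mul_comm (φ z), ← hx]
      exact (hmem x z h).1 (hw _ ((hquot x z).2 (hx ▸ mul_dvd_mul_left d hz)))
    obtain ⟨t, ht⟩ := this
    exact ⟨t, mul_left_cancel (a := e) (by rw [ht, mul_comm d, mul_assoc])⟩
  · intro hw
    obtain ⟨h, rfl⟩ := preimageIdeal_subset φ d hw
    rw [emb_mem_preimageIdeal] at hw
    intro y hy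
    obtain ⟨x, z, rfl⟩ := exists_right_fraction y
    exact (hmem x z h).2 (((hquot x z).1 hy).trans (mul_dvd_mul_right hw _))

theorem IsDivisorTheory.vClosure_preimageIdeal (hφ : IsDivisorTheory φ) (a : F) :
    vClosure (preimageIdeal φ a) = preimageIdeal φ a := by
  rw [preimageIdeal_eq, hφ.vClosure_image (hφ.preimage_nonempty a) (hφ.isGCDOf_preimage a),
    preimageIdeal_eq]

theorem IsDivisorTheory.vMul_preimageIdeal (hφ : IsDivisorTheory φ) (a b : F) :
    vMul (preimageIdeal φ a) (preimageIdeal φ b) = preimageIdeal φ (a * b) := by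
  rw [preimageIdeal_eq, preimageIdeal_eq, vMul, ← Set.image_mul]
  refine hφ.vClosure_image ((hφ.preimage_nonempty a).mul (hφ.preimage_nonempty b)) ?_
  rw [Set.image_mul]
  exact (hφ.isGCDOf_preimage a).mul hφ.isCompleteGCD ((hφ.preimage_nonempty a).image _)
    ((hφ.preimage_nonempty b).image _) (hφ.isGCDOf_preimage b)

theorem IsDivisorTheory.preimageIdeal_injective (hφ : IsDivisorTheory φ) :
    Function.Injective (preimageIdeal φ) := by
  intro a b h
  rw [preimageIdeal_eq, preimageIdeal_eq] at h
  have h' := (Set.image_injective.2 emb_injective) h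
  exact (h' ▸ hφ.isGCDOf_preimage a).unique hφ.isCompleteGCD (hφ.isGCDOf_preimage b)

/-- Ideals may be empty by definition, but gcds need non-empty sets. For the empty set,
`v`-invertibility would give `∅_v = H`, while divisoriality gives `∅_v = ∅`. -/
theorem VInvIdeal.nonempty (I : VInvIdeal H) : I.carrier.Nonempty := by
  by_contra hI
  rw [Set.not_nonempty_iff_eq_empty] at hI
  have h1 := I.isVInvertible.1
  have h2 := I.isDivisorial.1
  rw [vMul, hI, Set.empty_mul] at h1
  rw [hI] at h2
  exact Set.notMem_empty 1 (((h1.symm.trans h2) : base H = ∅) ▸ one_mem_base)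

end Basic

/-! ### The isomorphism onto the monoid of `v`-invertible `v`-ideals -/

section Iso

variable {H : Type u} [CancelMonoid H] [IsOre H] [IsNormalizing H]
  {F : Type v} [CommMonoid F] {φ : H →* F}

/-- Choose `x` and `e` with `φ x = a * e`. Then `x⁻¹ φ⁻¹(eF)` and `φ⁻¹(eF) x⁻¹` lie in the inverse,
and together with `φ⁻¹(aF)` they already suffice, since `a * e` is the gcd of the products `φ c * φ
g`. -/
theorem IsDivisorTheory.isVInvertible_preimageIdeal (hφ : IsDivisorTheory φ) (a : F) :
    IsVInvertible (preimageIdeal φ a) := by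
  have hF := hφ.isCompleteGCD
  have := hF.isCancelMul
  obtain ⟨e, x, hx⟩ := hφ.exists_mul_eq a
  have hquot : ∀ g : H, e ∣ φ g → emb g * (emb x)⁻¹ ∈ leftQuot (base H) (preimageIdeal φ a) := by
    intro g hg b hb
    obtain ⟨c, rfl⟩ := preimageIdeal_subset φ a hb
    apply mul_comm_mem_base
    rw [← mul_assoc, ← map_mul, hφ.1.emb_mul_inv_mem_base_iff, map_mul, hx]
    exact mul_dvd_mul (emb_mem_preimageIdeal.1 hb) hg
  have hquot' : ∀ g : H, e ∣ φ g → (emb x)⁻¹ * emb g ∈ leftQuot (base H) (preimageIdeal φ a) := by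
    intro g hg b hb
    obtain ⟨c, rfl⟩ := preimageIdeal_subset φ a hb
    rw [mul_assoc]
    apply mul_comm_mem_base
    rw [← map_mul, hφ.1.emb_mul_inv_mem_base_iff, map_mul, mul_comm, hx]
    exact mul_dvd_mul (emb_mem_preimageIdeal.1 hb) hg
  -- Passing to the gcd `a * e = φ x` of the `φ c * φ g` yields `φ x * φ r ∣ φ x * φ s`.
  have key : ∀ r s : H, (∀ c g : H, a ∣ φ c → e ∣ φ g → φ x * φ r ∣ φ s * φ c * φ g) →
      φ r ∣ φ s := by
    intro r s h
    have h1 : φ x * φ r ∣ a * e * φ s := by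
      refine ((hφ.isGCDOf_preimage a).mul hF ((hφ.preimage_nonempty a).image _)
        ((hφ.preimage_nonempty e).image _) (hφ.isGCDOf_preimage e)).dvd_mul hF
        (((hφ.preimage_nonempty a).image _).mul ((hφ.preimage_nonempty e).image _)) ?_
      rintro _ ⟨_, ⟨c, hc, rfl⟩, _, ⟨g, hg, rfl⟩, rfl⟩
      have := h c g hc hg
      rwa [mul_assoc, mul_comm (φ s)] at this
    rw [← hx] at h1
    obtain ⟨t, ht⟩ := h1
    exact ⟨t, mul_left_cancel (a := φ x) (by rw [ht, mul_assoc])⟩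
  rw [isVInvertible_iff]
  constructor
  · intro y hy
    obtain ⟨r, s, rfl⟩ := exists_left_fraction y
    apply mul_comm_mem_base
    rw [hφ.1.emb_mul_inv_mem_base_iff]
    refine key r s fun c g hc hg => ?_
    have h1 := hy (emb c) (emb_mem_preimageIdeal.2 hc) _ (hquot g hg)
    -- Membership in `H` is invariant under cyclic rotation. The left fraction for `y` and the form
    -- `g x⁻¹` make the two denominators adjacent; the other half uses the mirrored choices.
    have h2 : emb (s * c * g) * (emb (r * x))⁻¹ ∈ base H := by
      have := mul_comm_mem_base (x := emb g * (emb x)⁻¹ * (emb r)⁻¹) (y := emb s * emb c)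
        (by simpa only [mul_assoc] using h1)
      simpa [mul_assoc] using this
    rw [hφ.1.emb_mul_inv_mem_base_iff] at h2
    simpa only [map_mul, mul_comm (φ x)] using h2
  · intro y hy
    obtain ⟨r, s, rfl⟩ := exists_right_fraction y
    rw [hφ.1.emb_mul_inv_mem_base_iff]
    refine key r s fun c g hc hg => ?_
    have h1 := hy (emb c) (emb_mem_preimageIdeal.2 hc) _ (hquot' g hg)
    have h2 : emb (g * c * s) * (emb (x * r))⁻¹ ∈ base H := by
      have := mul_comm_mem_base (x := emb c * (emb s * (emb r)⁻¹) * (emb x)⁻¹) (y := emb g)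
        (by simpa only [mul_assoc] using h1)
      simpa [mul_assoc] using this
    rw [hφ.1.emb_mul_inv_mem_base_iff] at h2
    rwa [map_mul, map_mul, map_mul, mul_comm (φ g * φ c), mul_comm (φ g), ← mul_assoc] at h2

/-- The ideal `φ⁻¹(aF)` as an element of `I_v^*(H)`. -/
def IsDivisorTheory.vInvIdeal (hφ : IsDivisorTheory φ) (a : F) : VInvIdeal H where
  carrier := preimageIdeal φ a
  isIdeal := hφ.vClosure_preimageIdeal a ▸ isIdeal_vClosure (preimageIdeal_subset φ a)
  isDivisorial := hφ.vClosure_preimageIdeal a ▸ isDivisorial_vClosure (preimageIdeal φ a)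
  isVInvertible := hφ.isVInvertible_preimageIdeal a

theorem IsDivisorTheory.vInvIdeal_mul (hφ : IsDivisorTheory φ) (a b : F) :
    hφ.vInvIdeal (a * b) = hφ.vInvIdeal a * hφ.vInvIdeal b :=
  VInvIdeal.ext' (hφ.vMul_preimageIdeal a b).symm

theorem IsDivisorTheory.vInvIdeal_apply (hφ : IsDivisorTheory φ) (h : H) :
    hφ.vInvIdeal (φ h) = principalHom H h :=
  VInvIdeal.ext' (hφ.1.preimageIdeal_apply h)

/-- A preimage of `I` is the gcd of the image of `I` in `F`, since `I = I_v`. -/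
theorem IsDivisorTheory.vInvIdeal_surjective (hφ : IsDivisorTheory φ) :
    Function.Surjective hφ.vInvIdeal := by
  intro I
  obtain ⟨A, hA⟩ := Set.subset_range_iff_exists_image_eq.1 I.isIdeal.2
  have hne : A.Nonempty := Set.image_nonempty.1 (hA ▸ I.nonempty)
  obtain ⟨d, hd⟩ := hφ.isCompleteGCD.exists_gcd (φ '' A) (hne.image _)
  refine ⟨d, VInvIdeal.ext' ?_⟩
  change preimageIdeal φ d = I.carrier
  rw [← hφ.vClosure_image hne hd, hA]
  exact I.isDivisorial.1

theorem IsDivisorTheory.vInvIdeal_bijective (hφ : IsDivisorTheory φ) :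
    Function.Bijective hφ.vInvIdeal :=
  ⟨fun _ _ h => hφ.preimageIdeal_injective (congrArg VInvIdeal.carrier h),
    hφ.vInvIdeal_surjective⟩

theorem IsDivisorTheory.isVCommutative (hφ : IsDivisorTheory φ) : IsVCommutative H where
  mul_comm I J := by
    obtain ⟨a, rfl⟩ := hφ.vInvIdeal_surjective I
    obtain ⟨b, rfl⟩ := hφ.vInvIdeal_surjective J
    rw [← hφ.vInvIdeal_mul, ← hφ.vInvIdeal_mul, mul_comm]

/-- The isomorphism `F ≃ I_v^*(H)`, `a ↦ φ⁻¹(aF)`. -/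
noncomputable def IsDivisorTheory.vInvIdealEquiv (hφ : IsDivisorTheory φ) : F ≃* VInvIdeal H :=
  { Equiv.ofBijective hφ.vInvIdeal hφ.vInvIdeal_bijective with map_mul' := hφ.vInvIdeal_mul }

theorem IsDivisorTheory.vInvIdealEquiv_apply (hφ : IsDivisorTheory φ) (h : H) :
    hφ.vInvIdealEquiv (φ h) = principalHom H h :=
  hφ.vInvIdeal_apply h

theorem IsDivisorTheory.carrier_vInvIdealEquiv (hφ : IsDivisorTheory φ) (a : F) :
    (hφ.vInvIdealEquiv a).carrier = vClosure (preimageIdeal φ a) :=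
  (hφ.vClosure_preimageIdeal a).symm

end Iso

/-! ### Class groups -/

section ClassGroup

open Algebra (GrothendieckGroup)

variable {D : Type v} [CommMonoid D] {E : Type w} [CommMonoid E]

theorem grothendieckGroup_lift_of {G : Type w} [CommGroup G] (f : D →* G) (a : D) :
    GrothendieckGroup.lift f (GrothendieckGroup.of a) = f a :=
  DFunLike.congr_fun (GrothendieckGroup.lift.symm_apply_apply f) a

theorem grothendieckGroup_lift_comp_lift (e : D ≃* E) :
    (GrothendieckGroup.lift ((GrothendieckGroup.of (M := D)).comp (e.symm : E →* D))).comp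
      (GrothendieckGroup.lift ((GrothendieckGroup.of (M := E)).comp (e : D →* E))) =
        MonoidHom.id _ := by
  refine GrothendieckGroup.lift.symm.injective (MonoidHom.ext fun x => ?_)
  let f := (GrothendieckGroup.of (M := E)).comp (e : D →* E)
  let g := (GrothendieckGroup.of (M := D)).comp (e.symm : E →* D)
  refine (congrArg (GrothendieckGroup.lift g) (grothendieckGroup_lift_of f x)).trans ?_
  refine (grothendieckGroup_lift_of g (e x)).trans ?_
  exact congrArg GrothendieckGroup.of (e.symm_apply_apply x)

/-- The isomorphism of quotient groups induced by an isomorphism of commutative monoids. -/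
noncomputable def grothendieckCongr (e : D ≃* E) : GrothendieckGroup D ≃* GrothendieckGroup E :=
  MonoidHom.toMulEquiv
    (GrothendieckGroup.lift ((GrothendieckGroup.of (M := E)).comp (e : D →* E)))
    (GrothendieckGroup.lift ((GrothendieckGroup.of (M := D)).comp (e.symm : E →* D)))
    (grothendieckGroup_lift_comp_lift e) (grothendieckGroup_lift_comp_lift e.symm)

theorem grothendieckCongr_of (e : D ≃* E) (a : D) :
    grothendieckCongr e (GrothendieckGroup.of a) = GrothendieckGroup.of (e a) :=
  grothendieckGroup_lift_of ((GrothendieckGroup.of (M := E)).comp (e : D →* E)) a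

variable {H : Type u} [CancelMonoid H]

/-- An isomorphism of commutative monoids under `H` induces an isomorphism of class groups. -/
theorem exists_divClassGroup_mulEquiv {φ : H →* D} {ψ : H →* E} (e : D ≃* E)
    (he : ∀ h, e (φ h) = ψ h) :
    ∃ f : DivClassGroup φ ≃* DivClassGroup ψ, ∀ a, f (cls φ a) = cls ψ (e a) := by
  refine ⟨QuotientGroup.congr _ _ (grothendieckCongr e) ?_, fun a => ?_⟩
  -- The subgroups correspond because their generators do.
  · rw [imageSubgroup, imageSubgroup, MonoidHom.map_closure, ← Set.range_comp]
    congr 2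
    ext h
    exact (grothendieckCongr_of e (φ h)).trans (congrArg GrothendieckGroup.of (he h))
  · exact congrArg (QuotientGroup.mk (s := imageSubgroup ψ)) (grothendieckCongr_of e a)

theorem IsDivisorTheory.cls_surjective {φ : H →* D} (hφ : IsDivisorTheory φ) :
    Function.Surjective (cls φ) := by
  intro q
  induction q using QuotientGroup.induction_on with | H g =>
  induction g using Localization.ind with | H y =>
  obtain ⟨a, b⟩ := y
  obtain ⟨e, x, hx⟩ := hφ.exists_mul_eq b
  -- With `φ x = b * e`, the fraction `a / b` equals `(a * e) / φ x`, and `φ x` is trivial in the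
  -- class group.
  refine ⟨a * e, ?_⟩
  refine QuotientGroup.eq_iff_div_mem.2 ?_
  have hmem : GrothendieckGroup.of (φ x) ∈ imageSubgroup φ := Subgroup.subset_closure ⟨x, rfl⟩
  have hy : Localization.mk a b * GrothendieckGroup.of (b : D) = GrothendieckGroup.of a := by
    rw [Localization.mk_eq_monoidOf_mk'_apply]
    exact Submonoid.LocalizationMap.mk'_spec _ a b
  rw [map_mul, ← hy, mul_assoc, ← map_mul, ← hx, mul_div_cancel_left]
  exact hmem

end ClassGroup

end DivTheory

/-! ### Uniqueness of divisor theories -/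

theorem proposition4p15 (H : Type u) [CancelMonoid H] [DivTheory.IsOre H] :
    (∀ (F : Type v) [CommMonoid F] (φ : H →* F), DivTheory.IsDivisorTheory φ →
      ∃ (_ : DivTheory.IsNormalizing H) (_ : DivTheory.IsVCommutative H)
        (φs : F ≃* DivTheory.VInvIdeal H),
        (∀ a : F, (φs a).carrier = DivTheory.vClosure (DivTheory.preimageIdeal φ a)) ∧
        Function.Surjective (DivTheory.cls φ) ∧
        ∃ φbar : DivTheory.DivClassGroup φ ≃* DivTheory.VClassGroup H,
          ∀ a : F, φbar (DivTheory.cls φ a) =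
            DivTheory.cls (DivTheory.principalHom H) (φs a)) ∧
    (∀ (F₁ : Type v) [CommMonoid F₁] (F₂ : Type w) [CommMonoid F₂]
      (φ₁ : H →* F₁) (φ₂ : H →* F₂),
      DivTheory.IsDivisorTheory φ₁ → DivTheory.IsDivisorTheory φ₂ →
      ∃ Φ : F₁ ≃* F₂, (∀ h : H, Φ (φ₁ h) = φ₂ h) ∧
        (∀ Ψ : F₁ ≃* F₂, (∀ h : H, Ψ (φ₁ h) = φ₂ h) → Ψ = Φ) ∧
        ∃ Φbar : DivTheory.DivClassGroup φ₁ ≃* DivTheory.DivClassGroup φ₂,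
          ∀ a : F₁, Φbar (DivTheory.cls φ₁ a) = DivTheory.cls φ₂ (Φ a)) := by
  refine ⟨fun F _ φ hφ => ?_, fun F₁ _ F₂ _ φ₁ φ₂ h₁ h₂ => ?_⟩
  · have := hφ.1.isNormalizing
    have := hφ.isVCommutative
    exact ⟨inferInstance, inferInstance, hφ.vInvIdealEquiv, hφ.carrier_vInvIdealEquiv,
      hφ.cls_surjective,
      DivTheory.exists_divClassGroup_mulEquiv hφ.vInvIdealEquiv hφ.vInvIdealEquiv_apply⟩
  · have := h₁.1.isNormalizing
    -- Both `F₁` and `F₂` are identified with `I_v^*(H)`, compatibly with `h ↦ hH`.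
    have hΦ : ∀ h, (h₁.vInvIdealEquiv.trans h₂.vInvIdealEquiv.symm) (φ₁ h) = φ₂ h := fun h => by
      rw [MulEquiv.trans_apply, MulEquiv.symm_apply_eq, h₁.vInvIdealEquiv_apply,
        h₂.vInvIdealEquiv_apply]
    exact ⟨_, hΦ, fun Ψ hΨ => h₁.mulEquiv_unique h₂.isCompleteGCD hΨ hΦ,
      DivTheory.exists_divClassGroup_mulEquiv _ hΦ⟩
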